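/- For a set $S\subseteq\mathbb R^2$ and a finite set $C$ write $\rho(S,C)=\sup_{p\in S}\min_{c\in C}|p-c|$, and for an integer $k\ge 1$ let $\mathcal R_k(S)=\inf\{\rho(S,C): C\subseteq S,\ |C|=k\}$. A set $C\subseteq S$ with $|C|=k$ and $\rho(S,C)\le\alpha\,\mathcal R_k(S)$ is called an $\alpha$-approximate $k$-center of $S$. For $S=\bigcup_i Q_i$, a union of closed polygonal regions, this is the maximum domain-restricted $k$-center problem; for finite $S$ it is the discrete $k$-center problem. **Grid algorithm for convex polygons $F=\{P_1,\dots,P_m\}$, integer $k$, and $\varepsilon>0$.** Let $r_j$ be the radius of the smallest disk enclosing the vertices of $P_j$. Choose a cell length $\delta>0$ with $\delta\le\min(1,\varepsilon/4)\,r_j/k$ for every $j$, and an axis-parallel square grid of cell length $\delta$. Let $Y$ consist of all grid vertices lying in $\bigcup_j P_j$ and, for every grid vertex $x\notin\bigcup_j P_j$ and every $j$ such that $x$ lies in the Minkowski sum of $P_j$ with the closed disk of radius $\delta$ about the origin, the point of $P_j$ nearest to $x$. Return a $2$-approximate $k$-center of the finite set $Y$. **Algorithm for arbitrary polygons.** The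 input is a nonempty finite family of simple, not necessarily convex, polygons with closed regions $Q_1,\dots,Q_n$, an integer $k\ge1$, and $\varepsilon>0$. Triangulate each $Q_i$ into nondegenerate triangles with vertices among the vertices of the polygon, any two of which meet in a common (possibly empty) face. For every triangle $t$ obtained, apply the grid algorithm to the single triangle $t$ with $k$ and $\varepsilon$, giving $k$ points $X_t\subseteq t$. Compute a $2$-approximate $k$-center $C$ of the finite set $X=\bigcup_t X_t$. Let $C'$ result from $C$ by moving each center to a nearest point of $\bigcup_i Q_i$. **Theorem.** For every choice of the triangulations, all steps can be carried out. For every choice of the triangulations, the grids, and the $2$-approximate $k$-centers used in the steps, $C'=C$, and $C$ is a $(6+\varepsilon)$-approximate $k$-center of $\bigcup_i Q_i$: that is, $C\subseteq\bigcup_i Q_i$, $|C|=k$, and $$\sup_{p\in\bigcup_i Q_i}\ \min_{c\in C}|p-c|\ \le\ (6+\varepsilon)\,\mathcal R_k\Big(\bigcup_i Q_i\Big).$$ -/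

import Mathlib

open scoped Pointwise ENNReal

noncomputable section

namespace PolygonKCenter

/-- The Euclidean plane. -/
abbrev Plane : Type := EuclideanSpace ℝ (Fin 2)

/-! ### Simple polygons and their triangulations -/

/-- A polygon (a cyclic list of vertices) is simple if it has at least three vertices, the vertices
are pairwise distinct, and two different edges meet only in endpoints that they share. -/
def IsSimple {N : ℕ} (Q : Polygon Plane N) : Prop :=
  3 ≤ N ∧ Function.Injective Q.vertices ∧
    ∀ i j : Fin N, i ≠ j → Q.edgeSet ℝ i ∩ Q.edgeSet ℝ j ⊆
      {Q i, Q (finRotate N i)} ∩ {Q j, Q (finRotate N j)}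

/-- The closed region of a polygon: its boundary curve together with the points that the
boundary curve encloses (those in a bounded component of its complement). -/
def region {N : ℕ} (Q : Polygon Plane N) : Set Plane :=
  Q.boundary ℝ ∪
    {x | x ∉ Q.boundary ℝ ∧ Bornology.IsBounded (connectedComponentIn (Q.boundary ℝ)ᶜ x)}

/-- A triangulation of the region of a polygon: finitely many nondegenerate triangles, each given
by its three vertices, which are vertices of the polygon; two triangles meet in a common face
(possibly empty), and together the triangles fill the region. -/
structure IsTriangulation {N : ℕ} (Q : Polygon Plane N) (T : Finset (Finset Plane)) : Prop where
  card_eq : ∀ t ∈ T, t.card = 3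
  affineIndependent : ∀ t ∈ T, AffineIndependent ℝ (fun v : t => (v : Plane))
  vertices_subset : ∀ t ∈ T, (t : Set Plane) ⊆ Set.range Q.vertices
  inter_subset : ∀ s ∈ T, ∀ t ∈ T,
    convexHull ℝ (s : Set Plane) ∩ convexHull ℝ (t : Set Plane) ⊆
      convexHull ℝ ((s : Set Plane) ∩ (t : Set Plane))
  iUnion_eq : ⋃ t ∈ T, convexHull ℝ (t : Set Plane) = region Q

/-! ### The domain-restricted `k`-center problem -/

/-- The radius of the clustering of `S` by the centers `C`: the supremum over `p ∈ S` of the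
distance from `p` to a nearest center. -/
def clusterRadius (S C : Set Plane) : ℝ≥0∞ :=
  ⨆ p ∈ S, Metric.infEDist p C

/-- The optimal radius for covering the points of `S` by `k` centers chosen from `S`.
For a union of polygonal regions this is the maximum `k`-center objective, for a finite
set it is the discrete `k`-center objective. -/
def optRadius (k : ℕ) (S : Set Plane) : ℝ≥0∞ :=
  ⨅ C : {C : Set Plane // C ⊆ S ∧ C.encard = k}, clusterRadius S C

/-- `C` consists of `k` points of `S` and is within the factor `α` of the optimum. -/
def IsApproxKCenter (α : ℝ≥0∞) (k : ℕ) (S C : Set Plane) : Prop :=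
  C ⊆ S ∧ C.encard = k ∧ clusterRadius S C ≤ α * optRadius k S

/-! ### The grid algorithm for convex polygons

A convex polygon is given by its finite set of vertices, a set of convex polygons by a
finite set of such vertex sets. -/

/-- The radius of the smallest enclosing disk of a set of points. -/
def enclosingRadius (V : Set Plane) : ℝ :=
  sInf {ρ : ℝ | 0 ≤ ρ ∧ ∃ c : Plane, V ⊆ Metric.closedBall c ρ}

/-- The vertices of the axis-parallel square grid of cell length `δ` that has `o` as a vertex. -/
def grid (o : Plane) (δ : ℝ) : Set Plane :=
  {x | ∃ m : Fin 2 → ℤ, ∀ i, x i = o i + δ * m i}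

/-- The points of `S` that are nearest to `x`. -/
def nearestPoints (S : Set Plane) (x : Plane) : Set Plane :=
  {y | y ∈ S ∧ ∀ z ∈ S, dist x y ≤ dist x z}

/-- The union of the convex polygons in `F`. -/
def domain (F : Finset (Finset Plane)) : Set Plane :=
  ⋃ t ∈ F, convexHull ℝ (t : Set Plane)

/-- The Minkowski sum of the convex polygon with vertex set `t` and a disk of radius `δ`. -/
def expanded (δ : ℝ) (t : Finset Plane) : Set Plane :=
  convexHull ℝ (t : Set Plane) + Metric.closedBall (0 : Plane) δ

/-- The candidate points inside the polygons: the grid vertices that lie in a polygon and, for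
every grid vertex outside all polygons and every expanded polygon that contains it, the nearest
neighbor of the grid vertex in that polygon. -/
def candidates (F : Finset (Finset Plane)) (o : Plane) (δ : ℝ) : Set Plane :=
  {x | x ∈ grid o δ ∧ x ∈ domain F} ∪
    {y | ∃ x ∈ grid o δ, x ∉ domain F ∧ ∃ t ∈ F, x ∈ expanded δ t ∧
      y ∈ nearestPoints (convexHull ℝ (t : Set Plane)) x}

/-- `C` is a possible output of the grid algorithm for the convex polygons `F`: the cell length
is at most `r / k` and at most `(ε / 4) * (r / k)` for the smallest enclosing disk radius `r` of
each polygon, and `C` is a `2`-approximate discrete `k`-center of the candidate points. -/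
def IsConvexOutput (F : Finset (Finset Plane)) (k : ℕ) (ε : ℝ) (C : Set Plane) : Prop :=
  ∃ (o : Plane) (δ : ℝ), 0 < δ ∧
    (∀ t ∈ F, δ ≤ min 1 (ε / 4) * (enclosingRadius (t : Set Plane) / k)) ∧
    IsApproxKCenter 2 k (candidates F o δ) C

/-! ### The algorithm for arbitrary polygons -/

/-- `C` and `C'` are possible final values in a run of the algorithm on the polygons `P i` with
triangulations `T i`: the grid algorithm is applied to every triangle `t`, with output `X t`;
`C` is a `2`-approximate discrete `k`-center of the set of all these points, and `C'` results
from `C` by moving each center to a nearest point of the polygons. -/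
def IsOutput {ι : Type*} {N : ι → ℕ} (P : ∀ i, Polygon Plane (N i))
    (T : ι → Finset (Finset Plane)) (k : ℕ) (ε : ℝ) (C C' : Set Plane) : Prop :=
  ∃ X : Finset Plane → Set Plane,
    (∀ i, ∀ t ∈ T i, IsConvexOutput {t} k ε (X t)) ∧
    IsApproxKCenter 2 k (⋃ i, ⋃ t ∈ T i, X t) C ∧
    ∃ f : Plane → Plane, (∀ c ∈ C, f c ∈ nearestPoints (⋃ i, region (P i)) c) ∧ C' = f '' C

end PolygonKCenter

end

open Set Metric MeasureTheory

namespace PolygonKCenter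

/-! ### Coverings and `k`-center radii -/

/-! Suppose `k` disks of radius `ρ` cover the union of the regions. They cover each triangle, and
projecting their centers onto it costs nothing because it is convex. The candidates are `δ`-dense in
the triangle, so snapping the projected centers to candidates gives radius `ρ + δ`. The
`2`-approximation doubles this, and passing from triangle to candidates adds `δ`, for a total of `2ρ
+ 3δ`. A length count (`Covers.dist_le`) bounds the triangle's diameter by `2kρ`, whence `3δ ≤ ερ`
(`IsConvexOutput.covers`).

Thus `X` covers the union within `(2 + ε)ρ`. Moving the `k` centers into `X` doubles `ρ`, and the
final `2`-approximation doubles it again: `C` covers `X` within `4ρ`, hence the union within `(6 +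
ε)ρ`. All points stay in the regions, so the last move is the identity. -/

/-- Every point of `S` is within distance `ρ` of a point of `C`. -/
def Covers (C S : Set Plane) (ρ : ℝ) : Prop :=
  ∀ p ∈ S, ∃ c ∈ C, dist p c ≤ ρ

theorem Covers.clusterRadius_le {S C : Set Plane} {ρ : ℝ} (h : Covers C S ρ) :
    clusterRadius S C ≤ ENNReal.ofReal ρ := by
  refine iSup₂_le fun p hp => ?_
  obtain ⟨c, hc, hpc⟩ := h p hp
  refine (infEDist_le_edist_of_mem hc).trans ?_
  rw [edist_dist]
  exact ENNReal.ofReal_le_ofReal hpc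

theorem covers_of_clusterRadius_le {S C : Set Plane} {ρ : ℝ} (hC : C.Finite) (hne : C.Nonempty)
    (hρ : 0 ≤ ρ) (h : clusterRadius S C ≤ ENNReal.ofReal ρ) : Covers C S ρ := by
  intro p hp
  obtain ⟨c, hc, hpc⟩ := hC.isCompact.exists_infEDist_eq_edist hne p
  refine ⟨c, hc, ?_⟩
  have h1 : infEDist p C ≤ ENNReal.ofReal ρ :=
    (le_iSup₂ (f := fun p (_ : p ∈ S) => infEDist p C) p hp).trans h
  rw [hpc, edist_dist] at h1
  exact (ENNReal.ofReal_le_ofReal_iff hρ).1 h1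

theorem finite_of_encard_eq {C : Set Plane} {k : ℕ} (h : C.encard = k) : C.Finite :=
  finite_of_encard_eq_coe h

theorem nonempty_of_encard_eq {C : Set Plane} {k : ℕ} (hk : 1 ≤ k) (h : C.encard = k) :
    C.Nonempty := by
  rw [← encard_ne_zero, h]
  exact_mod_cast Nat.one_le_iff_ne_zero.1 hk

/-- A covering of `S` by at most `k` of its points bounds the optimal radius. -/
theorem optRadius_le {S A : Set Plane} {k : ℕ} {ρ : ℝ} (hAS : A ⊆ S) (hA : A.encard ≤ k)
    (hS : (k : ℕ∞) ≤ S.encard) (h : Covers A S ρ) : optRadius k S ≤ ENNReal.ofReal ρ := by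
  -- Extra centers never increase distances, so `A` may be padded to exactly `k` points.
  obtain ⟨B, hAB, hBS, hB⟩ := exists_superset_subset_encard_eq hAS hA hS
  refine (iInf_le _ (⟨B, hBS, hB⟩ : {C : Set Plane // C ⊆ S ∧ C.encard = k})).trans ?_
  refine Covers.clusterRadius_le fun p hp => ?_
  obtain ⟨a, ha, hpa⟩ := h p hp
  exact ⟨a, hAB ha, hpa⟩

theorem IsApproxKCenter.le_encard {S C : Set Plane} {α : ℝ≥0∞} {k : ℕ}
    (h : IsApproxKCenter α k S C) : (k : ℕ∞) ≤ S.encard :=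
  h.2.1 ▸ encard_le_encard h.1

/-- A `2`-approximate `k`-center covers within twice the radius of any covering by at most `k`
points of the set. -/
theorem IsApproxKCenter.covers {S C A : Set Plane} {k : ℕ} {ρ : ℝ} (hk : 1 ≤ k) (hρ : 0 ≤ ρ)
    (h : IsApproxKCenter 2 k S C) (hAS : A ⊆ S) (hA : A.encard ≤ k) (hcov : Covers A S ρ) :
    Covers C S (2 * ρ) := by
  refine covers_of_clusterRadius_le (finite_of_encard_eq h.2.1)
    (nonempty_of_encard_eq hk h.2.1) (by positivity) (h.2.2.trans ?_)
  rw [ENNReal.ofReal_mul zero_le_two, ENNReal.ofReal_ofNat]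
  gcongr
  exact optRadius_le hAS hA h.le_encard hcov

/-- Centers outside `S` can be replaced by points of `S` at the cost of doubling the radius. -/
theorem Covers.exists_subset {A S : Set Plane} {ρ : ℝ} (h : Covers A S ρ) :
    ∃ B ⊆ S, B.encard ≤ A.encard ∧ Covers B S (2 * ρ) := by
  classical
  -- Centers far from `S` get the junk value `0`; they serve no point of `S` and are filtered out
  -- below.
  have hg : ∀ a, ∃ x, (∃ y ∈ S, dist y a ≤ ρ) → x ∈ S ∧ dist x a ≤ ρ := fun a => by
    by_cases H : ∃ y ∈ S, dist y a ≤ ρ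
    · exact ⟨H.choose, fun _ => H.choose_spec⟩
    · exact ⟨0, fun H' => absurd H' H⟩
  choose g hg using hg
  refine ⟨g '' {a ∈ A | ∃ y ∈ S, dist y a ≤ ρ}, ?_,
    (encard_image_le _ _).trans (encard_le_encard (sep_subset _ _)), fun p hp => ?_⟩
  · rintro _ ⟨a, ⟨-, ha⟩, rfl⟩
    exact (hg a ha).1
  · obtain ⟨a, ha, hpa⟩ := h p hp
    refine ⟨g a, mem_image_of_mem _ ⟨ha, p, hp, hpa⟩, ?_⟩
    have h1 := (hg a ⟨p, hp, hpa⟩).2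
    have h2 := dist_triangle_right p (g a) a
    linarith

/-- A finite set with at least `k` points has a `2`-approximate `k`-center. -/
theorem exists_isApproxKCenter {S : Set Plane} (hS : S.Finite) {k : ℕ}
    (hk : (k : ℕ∞) ≤ S.encard) : ∃ C, IsApproxKCenter 2 k S C := by
  have : Finite {C : Set Plane // C ⊆ S ∧ C.encard = k} :=
    (hS.finite_subsets.subset fun C hC => hC.1 :
      {C : Set Plane | C ⊆ S ∧ C.encard = k}.Finite).to_subtype
  have : Nonempty {C : Set Plane // C ⊆ S ∧ C.encard = k} := by
    obtain ⟨C, h, h'⟩ := exists_subset_encard_eq hk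
    exact ⟨C, h, h'⟩
  obtain ⟨C, hC⟩ := exists_eq_ciInf_of_finite
    (f := fun C : {C : Set Plane // C ⊆ S ∧ C.encard = k} => clusterRadius S C)
  refine ⟨C, C.2.1, C.2.2, ?_⟩
  rw [hC, two_mul]
  exact le_self_add

/-! ### Nearest points of convex sets -/

theorem inner_le_zero_of_mem_nearestPoints {K : Set Plane} (hK : Convex ℝ K) {x y p : Plane}
    (hy : y ∈ nearestPoints K x) (hp : p ∈ K) : inner ℝ (x - y) (p - y) ≤ 0 := by
  refine (norm_eq_iInf_iff_real_inner_le_zero hK hy.1).1 ?_ p hp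
  have : Nonempty K := ⟨⟨y, hy.1⟩⟩
  refine le_antisymm (le_ciInf fun w => ?_)
    (ciInf_le (⟨0, by rintro _ ⟨w, rfl⟩; positivity⟩ :
      BddBelow (range fun w : K => ‖x - w‖)) ⟨y, hy.1⟩)
  simpa [dist_eq_norm] using hy.2 w w.2

/-- The angle at `y` between `x` and `p` is at least a right angle, so the law of cosines applies.
-/
theorem sq_add_sq_le_of_mem_nearestPoints {K : Set Plane} (hK : Convex ℝ K) {x y p : Plane}
    (hy : y ∈ nearestPoints K x) (hp : p ∈ K) :
    dist x y ^ 2 + dist p y ^ 2 ≤ dist p x ^ 2 := by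
  have h := inner_le_zero_of_mem_nearestPoints hK hy hp
  have h2 := norm_sub_sq_real (x - y) (p - y)
  rw [sub_sub_sub_cancel_right] at h2
  rw [dist_comm p x]
  simp only [dist_eq_norm]
  linarith

theorem dist_le_of_mem_nearestPoints {K : Set Plane} (hK : Convex ℝ K) {x y p : Plane}
    (hy : y ∈ nearestPoints K x) (hp : p ∈ K) : dist p y ≤ dist p x := by
  have := sq_add_sq_le_of_mem_nearestPoints hK hy hp
  exact le_of_sq_le_sq (by nlinarith [sq_nonneg (dist x y)]) dist_nonneg

theorem subsingleton_nearestPoints {K : Set Plane} (hK : Convex ℝ K) (x : Plane) :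
    (nearestPoints K x).Subsingleton := by
  intro y hy z hz
  have h := sq_add_sq_le_of_mem_nearestPoints hK hz hy.1
  have h1 := hy.2 z hz.1
  have h2 : dist y x ^ 2 ≤ dist x z ^ 2 := by
    rw [dist_comm y x]; gcongr
  have h3 : dist y z ^ 2 = 0 := le_antisymm (by linarith) (sq_nonneg _)
  exact dist_eq_zero.1 (pow_eq_zero_iff two_ne_zero |>.1 h3)

theorem nonempty_nearestPoints {K : Set Plane} (hK : IsCompact K) (hne : K.Nonempty)
    (x : Plane) : (nearestPoints K x).Nonempty := by
  obtain ⟨y, hy, h⟩ := hK.exists_infDist_eq_dist hne x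
  exact ⟨y, hy, fun z hz => h ▸ infDist_le_dist_of_mem hz⟩

/-- The nearest point of a set to one of its own points is the point itself. -/
theorem mem_nearestPoints_self_iff {S : Set Plane} {c y : Plane} (hc : c ∈ S) :
    y ∈ nearestPoints S c ↔ y = c := by
  refine ⟨fun h => ?_, ?_⟩
  · have := h.2 c hc
    rw [dist_self] at this
    exact (dist_le_zero.1 this).symm
  · rintro rfl
    exact ⟨hc, fun z _ => by simp⟩

/-- Projecting the centers onto a compact convex set does not increase the radius of a covering
of that set. -/
theorem Covers.exists_subset_convex {A K : Set Plane} (hK : Convex ℝ K) (hc : IsCompact K)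
    (hne : K.Nonempty) {ρ : ℝ} (h : Covers A K ρ) :
    ∃ B ⊆ K, B.encard ≤ A.encard ∧ Covers B K ρ := by
  choose g hg using nonempty_nearestPoints hc hne
  refine ⟨g '' A, ?_, encard_image_le _ _, fun p hp => ?_⟩
  · rintro _ ⟨a, -, rfl⟩
    exact (hg a).1
  · obtain ⟨a, ha, hpa⟩ := h p hp
    exact ⟨g a, mem_image_of_mem _ ha, (dist_le_of_mem_nearestPoints hK (hg a) hp).trans hpa⟩

/-! ### Diameters and enclosing disks -/

/-- A convex set covered by `k` disks of radius `ρ` has diameter at most `2 * k * ρ`. -/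
theorem Covers.dist_le {A K : Set Plane} (hK : Convex ℝ K) {k : ℕ} (hA : A.encard ≤ k) {ρ : ℝ}
    (hρ : 0 ≤ ρ) (h : Covers A K ρ) {p q : Plane} (hp : p ∈ K) (hq : q ∈ K) :
    dist p q ≤ 2 * k * ρ := by
  have hfin : A.Finite := finite_of_encard_le_coe hA
  rcases eq_or_ne p q with rfl | hpq
  · rw [dist_self]; positivity
  have hL : 0 < dist p q := dist_pos.2 hpq
  -- `I a` holds the parameters of the part of line `pq` in the disk about `a`. Its length is at
  -- most `2ρ / dist p q`, and at most `k` such sets cover `[0, 1]`.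
  let I : Plane → Set ℝ := fun a => {s | dist (AffineMap.lineMap p q s : Plane) a ≤ ρ}
  have hvol : ∀ a, volume (I a) ≤ ENNReal.ofReal (2 * ρ / dist p q) := fun a => by
    refine (Real.volume_le_diam _).trans (ediam_le fun s hs s' hs' => ?_)
    rw [edist_dist]
    refine ENNReal.ofReal_le_ofReal ?_
    rw [le_div_iff₀ hL, ← dist_lineMap_lineMap (𝕜 := ℝ)]
    have := dist_triangle_right (AffineMap.lineMap p q s : Plane) (AffineMap.lineMap p q s') a
    have h1 : dist (AffineMap.lineMap p q s : Plane) a ≤ ρ := hs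
    have h2 : dist (AffineMap.lineMap p q s' : Plane) a ≤ ρ := hs'
    linarith
  have hsub : Icc (0 : ℝ) 1 ⊆ ⋃ a ∈ hfin.toFinset, I a := fun s hs => by
    obtain ⟨a, ha, hd⟩ := h _ (hK.lineMap_mem hp hq hs)
    exact mem_biUnion (hfin.mem_toFinset.2 ha) hd
  have hcard : (hfin.toFinset.card : ℝ≥0∞) ≤ k := by
    rw [hfin.encard_eq_coe_toFinset_card] at hA
    exact_mod_cast hA
  have h1 : ENNReal.ofReal 1 ≤ ENNReal.ofReal (k * (2 * ρ / dist p q)) := by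
    calc ENNReal.ofReal 1 = volume (Icc (0 : ℝ) 1) := by simp
      _ ≤ volume (⋃ a ∈ hfin.toFinset, I a) := measure_mono hsub
      _ ≤ ∑ a ∈ hfin.toFinset, volume (I a) := measure_biUnion_finset_le _ _
      _ ≤ ∑ _a ∈ hfin.toFinset, ENNReal.ofReal (2 * ρ / dist p q) :=
        Finset.sum_le_sum fun a _ => hvol a
      _ = hfin.toFinset.card * ENNReal.ofReal (2 * ρ / dist p q) := by simp
      _ ≤ k * ENNReal.ofReal (2 * ρ / dist p q) := by gcongr
      _ = _ := by rw [ENNReal.ofReal_mul (Nat.cast_nonneg k), ENNReal.ofReal_natCast]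
  rw [ENNReal.ofReal_le_ofReal_iff (by positivity), ← mul_div_assoc, le_div_iff₀ hL] at h1
  linarith

theorem enclosingRadius_le {V : Set Plane} {c : Plane} {ρ : ℝ} (hρ : 0 ≤ ρ)
    (h : V ⊆ closedBall c ρ) : enclosingRadius V ≤ ρ :=
  csInf_le ⟨0, fun _ h => h.1⟩ ⟨hρ, c, h⟩

theorem half_dist_le_enclosingRadius {V : Set Plane} (hV : Bornology.IsBounded V) {a b : Plane}
    (ha : a ∈ V) (hb : b ∈ V) : dist a b / 2 ≤ enclosingRadius V := by
  obtain ⟨R, hR⟩ := hV.subset_closedBall 0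
  refine le_csInf ⟨max R 0, le_max_right _ _, 0,
    hR.trans (closedBall_subset_closedBall (le_max_left _ _))⟩ ?_
  rintro ρ ⟨-, c, hc⟩
  have := dist_triangle_right a b c
  have h1 := mem_closedBall.1 (hc ha)
  have h2 := mem_closedBall.1 (hc hb)
  linarith

/-- Three points with pairwise distances at most `d` lie in a disk of radius `2 * d / 3` about
their centroid. -/
theorem enclosingRadius_le_of_card_eq_three {t : Finset Plane} (ht : t.card = 3) {d : ℝ}
    (hd : ∀ a ∈ t, ∀ b ∈ t, dist a b ≤ d) : enclosingRadius (t : Set Plane) ≤ 2 * d / 3 := by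
  classical
  obtain ⟨a, b, c, -, -, -, rfl⟩ := Finset.card_eq_three.1 ht
  have hd0 : 0 ≤ d := dist_nonneg.trans (hd a (by simp) a (by simp))
  -- The vector from the centroid to a vertex is one third of the sum of two edge vectors. Jung's
  -- sharper constant `1/√3` is not needed.
  have key : ∀ u v w : Plane, dist u v ≤ d → dist u w ≤ d →
      dist u ((1 / 3 : ℝ) • (u + v + w)) ≤ 2 * d / 3 := fun u v w huv huw => by
    rw [dist_eq_norm] at *
    have : u - (1 / 3 : ℝ) • (u + v + w) = (1 / 3 : ℝ) • ((u - v) + (u - w)) := by module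
    rw [this, norm_smul, Real.norm_of_nonneg (by norm_num)]
    linarith [norm_add_le (u - v) (u - w)]
  refine enclosingRadius_le (c := (1 / 3 : ℝ) • (a + b + c)) (by positivity) ?_
  intro x hx
  simp only [Finset.coe_insert, Finset.coe_singleton, mem_insert_iff, mem_singleton_iff] at hx
  rw [mem_closedBall]
  rcases hx with rfl | rfl | rfl
  · exact key _ _ _ (hd _ (by simp) _ (by simp)) (hd _ (by simp) _ (by simp))
  · rw [add_comm a x]
    exact key _ _ _ (hd _ (by simp) _ (by simp)) (hd _ (by simp) _ (by simp))
  · rw [add_comm, ← add_assoc]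
    exact key _ _ _ (hd _ (by simp) _ (by simp)) (hd _ (by simp) _ (by simp))

/-! ### The candidate points of a convex polygon -/

/-- Rounding errs by at most `δ/2` per coordinate, so the distance is even at most `δ/√2`. -/
theorem exists_mem_grid_dist_le (o p : Plane) {δ : ℝ} (hδ : 0 < δ) :
    ∃ x ∈ grid o δ, dist p x ≤ δ := by
  let m : Fin 2 → ℤ := fun i => round ((p i - o i) / δ)
  refine ⟨WithLp.toLp 2 fun i => o i + δ * m i, ⟨m, fun i => rfl⟩, ?_⟩
  have hm : ∀ i, (p i - (o i + δ * m i)) ^ 2 ≤ (δ / 2) ^ 2 := fun i => by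
    have h1 := abs_sub_round ((p i - o i) / δ)
    have h2 : p i - (o i + δ * m i) = δ * ((p i - o i) / δ - m i) := by
      field_simp
      ring
    rw [← sq_abs, h2, abs_mul, abs_of_pos hδ]
    gcongr
    calc δ * _ ≤ δ * (1 / 2) := by gcongr
      _ = δ / 2 := by ring
  rw [EuclideanSpace.dist_eq]
  refine Real.sqrt_le_iff.2 ⟨hδ.le, ?_⟩
  simp only [Fin.sum_univ_two, Real.dist_eq, sq_abs]
  nlinarith [hm 0, hm 1, sq_nonneg δ]

theorem finite_grid_inter (o : Plane) {δ : ℝ} (hδ : 0 < δ) {S : Set Plane}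
    (hS : Bornology.IsBounded S) : (grid o δ ∩ S).Finite := by
  obtain ⟨R, hR⟩ := hS.subset_closedBall o
  let M : ℤ := ⌈R / δ⌉
  refine ((Set.Finite.pi' fun _ : Fin 2 => finite_Icc (-M) M).image
    fun m : Fin 2 → ℤ => (WithLp.toLp 2 fun i => o i + δ * m i : Plane)).subset ?_
  rintro x ⟨⟨m, hm⟩, hx⟩
  refine ⟨m, fun i => ?_, by ext i; exact (hm i).symm⟩
  have h1 : dist (x i) (o i) ≤ R := by
    have h2 : ‖(x - o) i‖ ≤ ‖x - o‖ := PiLp.norm_apply_le _ i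
    rw [dist_eq_norm]
    exact h2.trans (by simpa [dist_eq_norm] using hR hx)
  rw [hm i, Real.dist_eq, add_sub_cancel_left, abs_mul, abs_of_pos hδ] at h1
  have h3 : |(m i : ℝ)| ≤ R / δ := by
    rw [le_div_iff₀ hδ]; linarith
  have h4 : ((|m i| : ℤ) : ℝ) ≤ (M : ℤ) := by
    rw [Int.cast_abs]
    exact h3.trans (Int.le_ceil _)
  exact abs_le.1 (by exact_mod_cast h4)

theorem domain_singleton (t : Finset Plane) : domain {t} = convexHull ℝ (t : Set Plane) := by
  simp [domain]

theorem candidates_singleton_subset (t : Finset Plane) (o : Plane) (δ : ℝ) :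
    candidates {t} o δ ⊆ convexHull ℝ (t : Set Plane) := by
  rintro y (⟨-, hy⟩ | ⟨x, -, -, s, hs, -, hy⟩)
  · rwa [domain_singleton] at hy
  · rw [Finset.mem_singleton.1 hs] at hy
    exact hy.1

theorem isCompact_convexHull_coe (t : Finset Plane) : IsCompact (convexHull ℝ (t : Set Plane)) :=
  t.finite_toSet.isCompact_convexHull (𝕜 := ℝ)

theorem finite_candidates_singleton (t : Finset Plane) (o : Plane) {δ : ℝ} (hδ : 0 < δ) :
    (candidates {t} o δ).Finite := by
  have hK := (isCompact_convexHull_coe t).isBounded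
  refine ((finite_grid_inter o hδ hK).subset ?_).union
    (((finite_grid_inter o hδ (hK.add (isBounded_closedBall (x := (0 : Plane)) (r := δ)))).biUnion fun x _ =>
      (subsingleton_nearestPoints (convex_convexHull ℝ (t : Set Plane)) x).finite).subset ?_)
  · rintro x ⟨h, hx⟩
    exact ⟨h, by rwa [domain_singleton] at hx⟩
  · rintro y ⟨x, hx, -, s, hs, hxs, hy⟩
    rw [Finset.mem_singleton.1 hs] at hxs hy
    exact mem_biUnion ⟨hx, hxs⟩ hy

/-- Every point of a convex polygon is within `δ` of a candidate point. -/
theorem covers_candidates_singleton (t : Finset Plane) (o : Plane) {δ : ℝ} (hδ : 0 < δ) :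
    Covers (candidates {t} o δ) (convexHull ℝ (t : Set Plane)) δ := by
  intro p hp
  obtain ⟨x, hx, hpx⟩ := exists_mem_grid_dist_le o p hδ
  by_cases hxt : x ∈ domain {t}
  · exact ⟨x, Or.inl ⟨hx, hxt⟩, hpx⟩
  · obtain ⟨y, hy⟩ := nonempty_nearestPoints (isCompact_convexHull_coe t) ⟨p, hp⟩ x
    refine ⟨y, Or.inr ⟨x, hx, hxt, t, Finset.mem_singleton_self t, ?_, hy⟩,
      (dist_le_of_mem_nearestPoints (convex_convexHull ℝ _) hy hp).trans hpx⟩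
    refine ⟨p, hp, x - p, ?_, add_sub_cancel p x⟩
    rwa [mem_closedBall_zero_iff, ← dist_eq_norm, dist_comm]

theorem IsConvexOutput.subset {t : Finset Plane} {k : ℕ} {ε : ℝ} {X : Set Plane}
    (h : IsConvexOutput {t} k ε X) : X ⊆ convexHull ℝ (t : Set Plane) := by
  obtain ⟨o, δ, -, -, hX⟩ := h
  exact hX.1.trans (candidates_singleton_subset t o δ)

theorem IsConvexOutput.encard_eq {t : Finset Plane} {k : ℕ} {ε : ℝ} {X : Set Plane}
    (h : IsConvexOutput {t} k ε X) : X.encard = k := by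
  obtain ⟨o, δ, -, -, hX⟩ := h
  exact hX.2.1

/-- The grid algorithm can be carried out on every triangle. -/
theorem exists_isConvexOutput {t : Finset Plane} (ht : t.card = 3) {k : ℕ} (hk : 1 ≤ k) {ε : ℝ}
    (hε : 0 < ε) : ∃ X, IsConvexOutput {t} k ε X := by
  obtain ⟨a, ha, b, hb, hab⟩ := Finset.one_lt_card.1 (by omega : 1 < t.card)
  have hd : 0 < dist a b := dist_pos.2 hab
  have hk0 : (0 : ℝ) < k := by exact_mod_cast hk
  have hr : 0 < enclosingRadius (t : Set Plane) :=
    (half_pos hd).trans_le (half_dist_le_enclosingRadius t.finite_toSet.isBounded ha hb)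
  have hη : 0 < min 1 (ε / 4) * (enclosingRadius (t : Set Plane) / k) := by positivity
  -- The second bound ensures at least `k` candidates: fewer would force `dist a b ≤ 2kδ ≤ dist a b
  -- / 2`.
  let δ : ℝ := min (min 1 (ε / 4) * (enclosingRadius (t : Set Plane) / k)) (dist a b / (4 * k))
  have hδ : 0 < δ := lt_min hη (by positivity)
  have hcard : (k : ℕ∞) ≤ (candidates {t} 0 δ).encard := by
    by_contra! hlt
    have h1 := (covers_candidates_singleton t 0 hδ).dist_le (convex_convexHull ℝ _) hlt.le hδ.le
      (subset_convexHull ℝ _ ha) (subset_convexHull ℝ _ hb)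
    have h2 : δ * (4 * k) ≤ dist a b := (le_div_iff₀ (by positivity)).1 (min_le_right _ _)
    linarith
  obtain ⟨X, hX⟩ := exists_isApproxKCenter (finite_candidates_singleton t 0 hδ) hcard
  refine ⟨X, 0, δ, hδ, fun s hs => ?_, hX⟩
  rw [Finset.mem_singleton.1 hs]
  exact min_le_left _ _

/-- If at most `k` disks of radius `ρ`, with arbitrary centers, cover a triangle, then the output
of the grid algorithm covers it within `(2 + ε) * ρ`. -/
theorem IsConvexOutput.covers {t : Finset Plane} (ht : t.card = 3) {k : ℕ} (hk : 1 ≤ k) {ε : ℝ}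
    (hε : 0 < ε) {X A : Set Plane} (h : IsConvexOutput {t} k ε X) (hA : A.encard ≤ k) {ρ : ℝ}
    (hρ : 0 ≤ ρ) (hcov : Covers A (convexHull ℝ (t : Set Plane)) ρ) :
    Covers X (convexHull ℝ (t : Set Plane)) ((2 + ε) * ρ) := by
  obtain ⟨o, δ, hδ, hle, hX⟩ := h
  have hk0 : (0 : ℝ) < k := by exact_mod_cast hk
  have hconv := convex_convexHull ℝ (t : Set Plane)
  have hne : (convexHull ℝ (t : Set Plane)).Nonempty :=
    (Finset.coe_nonempty.2 (Finset.card_pos.1 (by omega))).convexHull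
  -- Diameter at most `2kρ` gives enclosing radius at most `4kρ/3`; multiplying by `ε/(4k)` gives `δ
  -- ≤ ερ/3`.
  have hδρ : 3 * δ ≤ ε * ρ := by
    have hr : enclosingRadius (t : Set Plane) ≤ 2 * (2 * k * ρ) / 3 :=
      enclosingRadius_le_of_card_eq_three ht fun a ha b hb =>
        hcov.dist_le hconv hA hρ (subset_convexHull ℝ _ ha) (subset_convexHull ℝ _ hb)
    have h1 : enclosingRadius (t : Set Plane) / k ≤ 4 / 3 * ρ := by
      rw [div_le_iff₀ hk0]; linarith
    have h2 : δ ≤ ε / 4 * (4 / 3 * ρ) :=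
      (hle t (Finset.mem_singleton_self t)).trans
        (mul_le_mul (min_le_right _ _) h1
          (div_nonneg (Real.sInf_nonneg fun _ h => h.1) hk0.le) (by positivity))
    linarith
  have hY := covers_candidates_singleton t o hδ
  obtain ⟨B, hBt, hB, hBcov⟩ := hcov.exists_subset_convex hconv (isCompact_convexHull_coe t) hne
  choose! g hgY hg using hY
  -- The projected centers `B`, snapped to candidates by `g`, compete with `X` at radius `ρ + δ`.
  have hXY : Covers X (candidates {t} o δ) (2 * (ρ + δ)) := by
    refine hX.covers hk (by positivity) (A := g '' B) ?_
      ((encard_image_le _ _).trans (hB.trans hA)) fun y hy => ?_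
    · rintro _ ⟨b, hb, rfl⟩
      exact hgY b (hBt hb)
    · obtain ⟨b, hb, hyb⟩ := hBcov y (candidates_singleton_subset t o δ hy)
      refine ⟨g b, mem_image_of_mem _ hb, (dist_triangle y b (g b)).trans ?_⟩
      exact add_le_add hyb (hg b (hBt hb))
  intro p hp
  obtain ⟨x, hx, hd⟩ := hXY (g p) (hgY p hp)
  refine ⟨x, hx, ?_⟩
  linarith [dist_triangle p (g p) x, hg p hp]

/-! ### Arbitrary polygons -/

theorem IsSimple.nonempty_region {N : ℕ} {Q : Polygon Plane N} (hQ : IsSimple Q) :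
    (region Q).Nonempty := by
  have hN : 0 < N := by have := hQ.1; omega
  refine ⟨Q ⟨0, hN⟩, Or.inl (mem_iUnion.2 ⟨⟨0, hN⟩, ?_⟩)⟩
  exact left_mem_affineSegment ℝ _ _

/-- If `X ⊆ D` covers `D` within `σ`, and at most `k` points cover `D` within `ρ`, then a
`2`-approximate `k`-center of `X` covers `D` within `σ + 4 * ρ`. -/
theorem covers_of_isApproxKCenter {D X C A : Set Plane} {k : ℕ} (hk : 1 ≤ k) {ρ σ : ℝ}
    (hρ : 0 ≤ ρ) (hXD : X ⊆ D) (hX : Covers X D σ) (hC : IsApproxKCenter 2 k X C)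
    (hA : A.encard ≤ k) (hcov : Covers A D ρ) : Covers C D (σ + 4 * ρ) := by
  -- `X` is not convex, so here moving the centers into the set costs a factor `2`, unlike in a
  -- triangle.
  obtain ⟨B, hBX, hB, hBcov⟩ := Covers.exists_subset fun x hx => hcov x (hXD hx)
  have hCX := hC.covers hk (by positivity) hBX (hB.trans hA) hBcov
  intro p hp
  obtain ⟨x, hx, hpx⟩ := hX p hp
  obtain ⟨c, hc, hxc⟩ := hCX x hx
  refine ⟨c, hc, ?_⟩
  linarith [dist_triangle p x c]

/-- The optimum is an infimum that need not be known to be attained, so each competitor `A` is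
compared at its own radius; an infinite radius is trivial. -/
theorem clusterRadius_le_mul_optRadius {D C : Set Plane} {k : ℕ} (hk : 1 ≤ k) {α : ℝ}
    (hα : 0 < α) (h : ∀ (A : Set Plane) (ρ : ℝ), 0 ≤ ρ → A.encard = k → Covers A D ρ → Covers C D (α * ρ)) :
    clusterRadius D C ≤ ENNReal.ofReal α * optRadius k D := by
  have hα0 : ENNReal.ofReal α ≠ 0 := (ENNReal.ofReal_pos.2 hα).ne'
  rw [optRadius, ENNReal.mul_iInf_of_ne hα0 ENNReal.ofReal_ne_top]
  refine le_iInf fun ⟨A, hAD, hA⟩ => ?_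
  rcases eq_or_ne (clusterRadius D A) ⊤ with htop | htop
  · simp [htop, ENNReal.mul_top hα0]
  have hcov : Covers A D (clusterRadius D A).toReal :=
    covers_of_clusterRadius_le (finite_of_encard_eq hA) (nonempty_of_encard_eq hk hA)
      ENNReal.toReal_nonneg (ENNReal.ofReal_toReal htop).ge
  refine (h A _ ENNReal.toReal_nonneg hA hcov).clusterRadius_le.trans ?_
  rw [ENNReal.ofReal_mul hα.le, ENNReal.ofReal_toReal htop]

end PolygonKCenter

open PolygonKCenter in
theorem mainTheorem10 {ι : Type*} [Finite ι] [Nonempty ι] {N : ι → ℕ}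
    (P : ∀ i, Polygon PolygonKCenter.Plane (N i))
    (hP : ∀ i, PolygonKCenter.IsSimple (P i))
    (T : ι → Finset (Finset PolygonKCenter.Plane))
    (hT : ∀ i, PolygonKCenter.IsTriangulation (P i) (T i))
    (k : ℕ) (hk : 1 ≤ k) (ε : ℝ) (hε : 0 < ε) :
    (∃ C C' : Set PolygonKCenter.Plane, PolygonKCenter.IsOutput P T k ε C C') ∧
    ∀ C C' : Set PolygonKCenter.Plane, PolygonKCenter.IsOutput P T k ε C C' →
      C' = C ∧
      PolygonKCenter.IsApproxKCenter (ENNReal.ofReal (6 + ε)) k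
        (⋃ i, PolygonKCenter.region (P i)) C := by
  have hsub : ∀ X : Finset Plane → Set Plane,
      (∀ i, ∀ t ∈ T i, IsConvexOutput {t} k ε (X t)) →
      ⋃ i, ⋃ t ∈ T i, X t ⊆ ⋃ i, region (P i) := fun X hX =>
    iUnion_mono fun i => by
      rw [← (hT i).iUnion_eq]
      exact iUnion₂_mono fun t ht => (hX i t ht).subset
  constructor
  · have hex : ∀ t : Finset Plane, ∃ X, t.card = 3 → IsConvexOutput {t} k ε X := fun t => by
      by_cases ht : t.card = 3
      · obtain ⟨X, hX⟩ := exists_isConvexOutput ht hk hε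
        exact ⟨X, fun _ => hX⟩
      · exact ⟨∅, fun h => absurd h ht⟩
    choose X hX using hex
    have hX' : ∀ i, ∀ t ∈ T i, IsConvexOutput {t} k ε (X t) :=
      fun i t ht => hX t ((hT i).card_eq t ht)
    have hfin : (⋃ i, ⋃ t ∈ T i, X t).Finite :=
      finite_iUnion fun i => (T i).finite_toSet.biUnion fun t ht =>
        finite_of_encard_eq (hX' i t ht).encard_eq
    -- A single triangle already contributes `k` points, and one exists because a region is
    -- nonempty.
    have hcard : (k : ℕ∞) ≤ (⋃ i, ⋃ t ∈ T i, X t).encard := by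
      obtain ⟨i⟩ := ‹Nonempty ι›
      obtain ⟨p, hp⟩ := (hP i).nonempty_region
      rw [← (hT i).iUnion_eq] at hp
      obtain ⟨t, ht, -⟩ := mem_iUnion₂.1 hp
      rw [← (hX' i t ht).encard_eq]
      exact encard_le_encard ((subset_iUnion₂ (s := fun t (_ : t ∈ T i) => X t) t ht).trans
        (subset_iUnion (fun i => ⋃ t ∈ T i, X t) i))
    obtain ⟨C, hC⟩ := exists_isApproxKCenter hfin hcard
    exact ⟨C, C, X, hX', hC, id,
      fun c hc => (mem_nearestPoints_self_iff (hsub X hX' (hC.1 hc))).2 rfl, (image_id C).symm⟩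
  · rintro C C' ⟨X, hX, hC, f, hf, rfl⟩
    have hCD := hC.1.trans (hsub X hX)
    refine ⟨?_, hCD, hC.2.1, clusterRadius_le_mul_optRadius hk (by positivity) ?_⟩
    · rw [image_congr fun c hc => (mem_nearestPoints_self_iff (hCD hc)).1 (hf c hc), image_id']
    · intro A ρ hρ hA hcov
      have hXcov : Covers (⋃ i, ⋃ t ∈ T i, X t) (⋃ i, region (P i)) ((2 + ε) * ρ) := by
        intro p hp
        obtain ⟨i, hi⟩ := mem_iUnion.1 hp
        rw [← (hT i).iUnion_eq] at hi
        obtain ⟨t, ht, hpt⟩ := mem_iUnion₂.1 hi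
        -- The centers in `A` may lie outside `t`, which is why the triangle bound allows arbitrary
        -- centers.
        have hcovt : Covers A (convexHull ℝ (t : Set Plane)) ρ := fun q hq =>
          hcov q (mem_iUnion.2 ⟨i, (hT i).iUnion_eq ▸ mem_iUnion₂.2 ⟨t, ht, hq⟩⟩)
        obtain ⟨x, hx, hd⟩ := (hX i t ht).covers ((hT i).card_eq t ht) hk hε hA.le hρ hcovt p hpt
        exact ⟨x, mem_iUnion.2 ⟨i, mem_iUnion₂.2 ⟨t, ht, hx⟩⟩, hd⟩
      have := covers_of_isApproxKCenter hk hρ (hsub X hX) hXcov hC hA.le hcov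
      rwa [show (2 + ε) * ρ + 4 * ρ = (6 + ε) * ρ by ring] at this
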